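/- Let $\mathcal R_{II}$ be the set of complex symmetric matrices $\begin{pmatrix} z_{11}&z\\ z&z_{22}\end{pmatrix}$ of operator norm less than $1$ (with respect to the Euclidean norm of $\mathbb C^2$), and let the tetrablock $\mathbb E\subset\mathbb C^3$ be its image under $(z_{11},z_{22},z)\mapsto(z_{11},z_{22},z_{11}z_{22}-z^2)$. Let $\mathbb D$ be the open unit disc, and let $k_{\mathbb E}$ be the Kobayashi distance of $\mathbb E$, i.e. the largest pseudodistance on $\mathbb E$ not exceeding the Lempert function $$l_{\mathbb E}(z,w)=\inf\{\tanh^{-1}|\alpha| : \alpha\in\mathbb D,\ \exists\, f:\mathbb D\to\mathbb E \text{ holomorphic with } f(0)=z,\ f(\alpha)=w\}.$$ Then $k_{\mathbb E}$ is a (finite) distance on $\mathbb E$, and the metric space $(\mathbb E,k_{\mathbb E})$ is not Gromov hyperbolic: with $(x,y)_w=k_{\mathbb E}(x,w)+k_{\mathbb E}(w,y)-k_{\mathbb E}(x,y)$, $$\sup_{p,q,x,w\in\mathbb E}\big(\min\{(p,x)_w,(x,q)_w\}-(p,q)_w\big)=\infty .$$ -/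

import Mathlib

open scoped ENNReal

noncomputable section

/-- A pseudodistance on `X`, with values in `[0, ∞]`. -/
structure IsPseudodistance {X : Type*} (d : X → X → ℝ≥0∞) : Prop where
  self : ∀ x, d x x = 0
  symm : ∀ x y, d x y = d y x
  triangle : ∀ x y z, d x z ≤ d x y + d y z

/-- The Lempert function of `D`: the infimum of `artanh |α|` over all `α` in the open unit disc for
which there is a holomorphic map `f` from the unit disc to `D` with `f 0 = z` and `f α = w`
(it is `∞` when there is no such `α`). -/
def lempertFunction {V : Type*} [NormedAddCommGroup V] [NormedSpace ℂ V] (D : Set V)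
    (z w : D) : ℝ≥0∞ :=
  ⨅ (α : ℂ) (_ : α ∈ Metric.ball (0 : ℂ) 1)
    (_ : ∃ f : ℂ → V, DifferentiableOn ℂ f (Metric.ball 0 1) ∧
      Set.MapsTo f (Metric.ball 0 1) D ∧ f 0 = z ∧ f α = w),
    ENNReal.ofReal (Real.artanh ‖α‖)

/-- The Kobayashi distance of `D`: the largest pseudodistance on `D` that does not exceed the
Lempert function (see `isGreatest_kobayashiDist`). -/
def kobayashiDist {V : Type*} [NormedAddCommGroup V] [NormedSpace ℂ V] (D : Set V) :
    D → D → ℝ≥0∞ :=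
  sSup {d : D → D → ℝ≥0∞ | IsPseudodistance d ∧ ∀ z w, d z w ≤ lempertFunction D z w}

theorem isGreatest_kobayashiDist {V : Type*} [NormedAddCommGroup V] [NormedSpace ℂ V]
    (D : Set V) :
    IsGreatest {d : D → D → ℝ≥0∞ | IsPseudodistance d ∧ ∀ z w, d z w ≤ lempertFunction D z w}
      (kobayashiDist D) := by
  refine ⟨⟨⟨fun x => ?_, fun x y => ?_, fun x y z => ?_⟩, fun z w => ?_⟩, fun d hd => le_sSup hd⟩
  · simp only [kobayashiDist, sSup_apply, iSup_apply, ENNReal.iSup_eq_zero]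
    exact fun d => d.2.1.self x
  · simp only [kobayashiDist, sSup_apply, iSup_apply]
    exact iSup_congr fun d => d.2.1.symm x y
  · simp only [kobayashiDist, sSup_apply, iSup_apply]
    refine iSup_le fun d => (d.2.1.triangle x y z).trans (add_le_add ?_ ?_)
    · exact le_iSup (fun e : {d : D → D → ℝ≥0∞ |
        IsPseudodistance d ∧ ∀ z w, d z w ≤ lempertFunction D z w} => e.1 x y) d
    · exact le_iSup (fun e : {d : D → D → ℝ≥0∞ |
        IsPseudodistance d ∧ ∀ z w, d z w ≤ lempertFunction D z w} => e.1 y z) d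
  · simp only [kobayashiDist, sSup_apply, iSup_apply]
    exact iSup_le fun d => d.2.2 z w

/-- The Gromov product `(x, y)_z` (without the factor `1 / 2`). -/
def gromovProduct {X : Type*} (d : X → X → ℝ) (x y z : X) : ℝ :=
  d x z + d z y - d x y

/-- Gromov hyperbolicity of a space `X` with distance `d`:
`min {(p, x)_w, (x, q)_w} - (p, q)_w` is bounded above. -/
def IsGromovHyperbolic {X : Type*} (d : X → X → ℝ) : Prop :=
  ∃ C : ℝ, ∀ p q x w : X,
    min (gromovProduct d p x w) (gromovProduct d x q w) - gromovProduct d p q w ≤ C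

/-- The classical Cartan domain of the second type: symmetric complex `2 × 2` matrices of operator
norm less than `1` (with respect to the Euclidean norm of `ℂ²`). -/
def cartanDomainII : Set (Matrix (Fin 2) (Fin 2) ℂ) :=
  {Z | Z.transpose = Z ∧ ‖Matrix.toEuclideanCLM (𝕜 := ℂ) Z‖ < 1}

/-- The map `(z₁₁, z₂₂, z) ↦ (z₁₁, z₂₂, z₁₁ z₂₂ - z²)`, where `(z₁₁, z₂₂, z)` stands for the
symmetric matrix with diagonal entries `z₁₁`, `z₂₂` and off-diagonal entry `z`. -/
def tetrablockMap (Z : Matrix (Fin 2) (Fin 2) ℂ) : EuclideanSpace ℂ (Fin 3) :=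
  !₂[Z 0 0, Z 1 1, Z 0 0 * Z 1 1 - Z 0 1 ^ 2]

/-- The tetrablock. -/
def tetrablock : Set (EuclideanSpace ℂ (Fin 3)) :=
  tetrablockMap '' cartanDomainII

end

open Metric Set Matrix

/-! Diagonal matrices embed the bidisc in the tetrablock by `(a, b) ↦ (a, b, a * b)`, and the first
two coordinates project back to the disc. In the coordinates `(artanh a, artanh b)` the real bidisc
points behave like a plane with the sup norm, which is not hyperbolic. Upper bounds come from
explicit discs in the bidisc. Lower bounds come from `edist_le_kobayashiDist`: a map nonexpanding
along discs pulls back a pseudodistance competing in the supremum. It is applied to `busemann` of a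
coordinate, which equals `artanh` on real points, so the Poincaré distance itself is not needed. -/

theorem kobayashiDist_le_lempertFunction {V : Type*} [NormedAddCommGroup V] [NormedSpace ℂ V]
    (D : Set V) (z w : D) : kobayashiDist D z w ≤ lempertFunction D z w :=
  (isGreatest_kobayashiDist D).1.2 z w

/-- A holomorphic disc through `z` and `w` bounds their Kobayashi distance from above. -/
theorem kobayashiDist_le_of_disc {V : Type*} [NormedAddCommGroup V] [NormedSpace ℂ V]
    {D : Set V} {z w : D} {α : ℂ} (hα : α ∈ ball (0 : ℂ) 1) {f : ℂ → V}
    (hf : DifferentiableOn ℂ f (ball 0 1)) (hD : MapsTo f (ball 0 1) D) (h0 : f 0 = z)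
    (h1 : f α = w) : kobayashiDist D z w ≤ ENNReal.ofReal (Real.artanh ‖α‖) :=
  (kobayashiDist_le_lempertFunction D z w).trans
    (iInf_le_of_le α (iInf_le_of_le hα (iInf_le_of_le ⟨f, hf, hD, h0, h1⟩ le_rfl)))

/-- A map that is nonexpanding along holomorphic discs is nonexpanding for the Kobayashi
distance. -/
theorem edist_le_kobayashiDist {V F : Type*} [NormedAddCommGroup V] [NormedSpace ℂ V]
    [PseudoMetricSpace F] {D : Set V} (φ : V → F)
    (h : ∀ f : ℂ → V, DifferentiableOn ℂ f (ball 0 1) → MapsTo f (ball 0 1) D →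
      ∀ α ∈ ball (0 : ℂ) 1, dist (φ (f 0)) (φ (f α)) ≤ Real.artanh ‖α‖) (z w : D) :
    edist (φ z) (φ w) ≤ kobayashiDist D z w := by
  suffices hφ : (fun z w : D => edist (φ z) (φ w)) ∈ {d : D → D → ℝ≥0∞ |
      IsPseudodistance d ∧ ∀ z w, d z w ≤ lempertFunction D z w} from
    (isGreatest_kobayashiDist D).2 hφ z w
  refine ⟨⟨fun _ => edist_self _, fun _ _ => edist_comm _ _, fun _ _ _ => edist_triangle _ _ _⟩,
    fun z w => ?_⟩
  refine le_iInf fun α => le_iInf fun hα => le_iInf fun ⟨f, hf, hD, h0, h1⟩ => ?_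
  beta_reduce
  rw [← h0, ← h1, edist_dist]
  exact ENNReal.ofReal_le_ofReal (h f hf hD α hα)

/-! ### Lower bounds: Harnack, Busemann and Schwarz. -/

/-- Harnack's inequality for the real part of a holomorphic function on the unit disc. -/
theorem harnack_re {g : ℂ → ℂ} (hg : DifferentiableOn ℂ g (ball 0 1))
    (hpos : ∀ z ∈ ball (0 : ℂ) 1, 0 < (g z).re) {α : ℂ} (hα : α ∈ ball (0 : ℂ) 1) :
    (g α).re * (1 - ‖α‖) ≤ (g 0).re * (1 + ‖α‖) ∧
      (g 0).re * (1 - ‖α‖) ≤ (g α).re * (1 + ‖α‖) := by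
  have h0 : 0 < (g 0).re := hpos 0 (by simp)
  have hα' := hpos α hα
  have hne : ∀ z ∈ ball (0 : ℂ) 1, g z + (starRingEnd ℂ) (g 0) ≠ 0 := fun z hz h => by
    have := congrArg Complex.re h
    have := hpos z hz
    simp at *
    linarith
  -- Schwarz's lemma for `g` followed by the Cayley map of the right half-plane that sends `g 0` to
  -- `0`.
  have hS := Complex.norm_le_norm_of_mapsTo_ball (R := 1) (z := α)
    (f := fun z => (g z - g 0) / (g z + (starRingEnd ℂ) (g 0)))
    ((hg.sub_const _).div (hg.add_const _) hne) (fun z hz => by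
      rw [mem_closedBall_zero_iff, norm_div]
      refine div_le_one_of_le₀ ?_ (norm_nonneg _)
      rw [← sq_le_sq₀ (norm_nonneg _) (norm_nonneg _), Complex.sq_norm, Complex.sq_norm,
        Complex.normSq_apply, Complex.normSq_apply]
      have := mul_pos (hpos z hz) h0
      simp
      nlinarith) (by simp) (by simpa using hα)
  rw [norm_div, div_le_iff₀ (norm_pos_iff.2 (hne α hα)),
    ← sq_le_sq₀ (norm_nonneg _) (by positivity), mul_pow, Complex.sq_norm (_ - _),
    Complex.sq_norm (_ + _), Complex.normSq_apply, Complex.normSq_apply] at hS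
  simp only [Complex.sub_re, Complex.sub_im, Complex.add_re, Complex.add_im, Complex.conj_re,
    Complex.conj_im] at hS
  have hρ : ‖α‖ < 1 := by simpa using hα
  have hρ2 : ‖α‖ ^ 2 ≤ 1 := pow_le_one₀ (norm_nonneg _) hρ.le
  have habs : |(g α).re - (g 0).re| ≤ ‖α‖ * ((g α).re + (g 0).re) := by
    refine abs_le_of_sq_le_sq ?_ (by positivity)
    -- Both sides of `hS` contain the same square of imaginary parts; it can be dropped since `‖α‖ ^
    -- 2 ≤ 1`.
    nlinarith [mul_nonneg (sub_nonneg.2 hρ2) (mul_self_nonneg ((g α).im - (g 0).im))]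
  have := abs_le.1 habs
  constructor <;> linarith

/-- The Busemann function of the Poincaré distance at the boundary point `1`. -/
noncomputable def busemann (z : ℂ) : ℝ :=
  1 / 2 * Real.log ((1 + z) / (1 - z)).re

theorem re_cayley_pos {z : ℂ} (hz : ‖z‖ < 1) : 0 < ((1 + z) / (1 - z)).re := by
  have hne : 1 - z ≠ 0 := fun h => by simp [← sub_eq_zero.1 h] at hz
  have hsq : ‖z‖ ^ 2 < 1 := pow_lt_one₀ (norm_nonneg _) hz two_ne_zero
  rw [Complex.sq_norm, Complex.normSq_apply] at hsq
  rw [Complex.div_re, ← add_div]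
  refine div_pos ?_ (Complex.normSq_pos.2 hne)
  simp
  nlinarith

/-- Harnack bounds the ratio of the real parts of the Cayley transforms by `(1 + ‖α‖) / (1 - ‖α‖)`,
whose half logarithm is `artanh ‖α‖`. -/
theorem dist_busemann_le_artanh {f : ℂ → ℂ} (hf : DifferentiableOn ℂ f (ball 0 1))
    (hD : ∀ z ∈ ball (0 : ℂ) 1, ‖f z‖ < 1) {α : ℂ} (hα : α ∈ ball (0 : ℂ) 1) :
    dist (busemann (f 0)) (busemann (f α)) ≤ Real.artanh ‖α‖ := by
  have hne : ∀ z ∈ ball (0 : ℂ) 1, 1 - f z ≠ 0 := fun z hz h => by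
    have := hD z hz
    simp [← sub_eq_zero.1 h] at this
  obtain ⟨h1, h2⟩ := harnack_re (g := fun z => (1 + f z) / (1 - f z))
    ((hf.const_add 1).div (hf.const_sub 1) hne) (fun z hz => re_cayley_pos (hD z hz)) hα
  have hρ : ‖α‖ < 1 := by simpa using hα
  have hρ0 := norm_nonneg α
  have h0 := re_cayley_pos (hD 0 (by simp))
  have hα' := re_cayley_pos (hD α hα)
  have hl1 := Real.log_le_log (by nlinarith) h1
  have hl2 := Real.log_le_log (by nlinarith) h2
  rw [Real.log_mul (by positivity) (by linarith), Real.log_mul (by positivity) (by linarith)]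
    at hl1 hl2
  rw [Real.artanh_eq_half_log ⟨by linarith, hρ.le⟩, Real.log_div (by linarith) (by linarith),
    Real.dist_eq, abs_le]
  unfold busemann
  constructor <;> linarith

theorem busemann_ofReal {r : ℝ} (hr : |r| ≤ 1) : busemann r = Real.artanh r := by
  rw [Real.artanh_eq_half_log (abs_le.1 hr), busemann]
  norm_cast

theorem half_le_artanh {x : ℝ} (h0 : 0 ≤ x) (h1 : x < 1) : x / 2 ≤ Real.artanh x := by
  have hpos : 0 < (1 + x) / (1 - x) := div_pos (by linarith) (by linarith)
  have h := Real.one_sub_inv_le_log_of_pos hpos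
  rw [Real.artanh_eq_half_log ⟨by linarith, h1.le⟩]
  have : x ≤ 1 - ((1 + x) / (1 - x))⁻¹ := by
    rw [inv_div, le_sub_iff_add_le, ← le_sub_iff_add_le', div_le_iff₀ (by linarith)]
    nlinarith
  linarith

/-- The Kobayashi distance of a bounded set separates points. -/
theorem eq_of_kobayashiDist_eq_zero {V : Type*} [NormedAddCommGroup V] [NormedSpace ℂ V]
    {D : Set V} {M : ℝ} (hM : 0 < M) (hD : ∀ z ∈ D, ‖z‖ ≤ M) {z w : D}
    (h : kobayashiDist D z w = 0) : z = w := by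
  -- Schwarz gives `2 * M * ‖α‖`, and `‖α‖ / 2 ≤ artanh ‖α‖`; hence the factor `4 * M`.
  have key := edist_le_kobayashiDist (D := D) (fun v : V => ((4 * M)⁻¹ : ℝ) • v)
    (fun f hf hfD α hα => by
      have h0 : (0 : ℂ) ∈ ball (0 : ℂ) 1 := by simp
      have hS := Complex.dist_le_div_mul_dist_of_mapsTo_ball (R₂ := 2 * M) hf (fun z hz => by
        rw [mem_closedBall, dist_eq_norm]
        linarith [norm_sub_le (f z) (f 0), hD _ (hfD hz), hD _ (hfD h0)]) hα
      have hα1 : ‖α‖ < 1 := by simpa using hα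
      refine le_trans ?_ (half_le_artanh (norm_nonneg α) hα1)
      rw [dist_smul₀, dist_comm, Real.norm_of_nonneg (by positivity),
        inv_mul_le_iff₀ (by positivity)]
      rw [div_one, dist_zero_right] at hS
      linarith) z w
  rw [h, nonpos_iff_eq_zero, edist_eq_zero] at key
  exact Subtype.ext (smul_right_injective V (by positivity : (4 * M)⁻¹ ≠ 0) key)

/-! ### Geometry of the tetrablock. -/

theorem Matrix.norm_entry_le_norm_toEuclideanCLM {n : Type*} [Fintype n] [DecidableEq n]
    (A : Matrix n n ℂ) (i j : n) : ‖A i j‖ ≤ ‖Matrix.toEuclideanCLM (𝕜 := ℂ) A‖ := by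
  have h := (Matrix.toEuclideanCLM (𝕜 := ℂ) A).le_opNorm (EuclideanSpace.single j 1)
  rw [PiLp.norm_single, norm_one, mul_one] at h
  refine le_trans ?_ ((PiLp.norm_apply_le _ i).trans h)
  simp [Matrix.ofLp_toEuclideanCLM]

theorem norm_apply_zero_lt_one_of_mem_tetrablock {z : EuclideanSpace ℂ (Fin 3)}
    (hz : z ∈ tetrablock) : ‖z 0‖ < 1 := by
  obtain ⟨Z, ⟨-, hZ⟩, rfl⟩ := hz
  exact (Z.norm_entry_le_norm_toEuclideanCLM 0 0).trans_lt hZ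

theorem norm_apply_one_lt_one_of_mem_tetrablock {z : EuclideanSpace ℂ (Fin 3)}
    (hz : z ∈ tetrablock) : ‖z 1‖ < 1 := by
  obtain ⟨Z, ⟨-, hZ⟩, rfl⟩ := hz
  exact (Z.norm_entry_le_norm_toEuclideanCLM 1 1).trans_lt hZ

theorem norm_le_of_mem_tetrablock {z : EuclideanSpace ℂ (Fin 3)} (hz : z ∈ tetrablock) :
    ‖z‖ ≤ 3 := by
  have h0 := norm_apply_zero_lt_one_of_mem_tetrablock hz
  have h1 := norm_apply_one_lt_one_of_mem_tetrablock hz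
  have h2 : ‖z 2‖ ≤ 2 := by
    obtain ⟨Z, ⟨-, hZ⟩, rfl⟩ := hz
    have h (i j) := (Z.norm_entry_le_norm_toEuclideanCLM i j).trans hZ.le
    calc ‖Z 0 0 * Z 1 1 - Z 0 1 ^ 2‖ ≤ ‖Z 0 0‖ * ‖Z 1 1‖ + ‖Z 0 1‖ ^ 2 :=
          (norm_sub_le _ _).trans_eq (by rw [norm_mul, norm_pow])
      _ ≤ 1 * 1 + 1 ^ 2 := by gcongr <;> exact h _ _
      _ = 2 := by norm_num
  rw [EuclideanSpace.norm_eq, Real.sqrt_le_left (by norm_num), Fin.sum_univ_three]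
  nlinarith [norm_nonneg (z 0), norm_nonneg (z 1), norm_nonneg (z 2)]

theorem bidisc_subset_tetrablock {a b : ℂ} (ha : ‖a‖ < 1) (hb : ‖b‖ < 1) :
    !₂[a, b, a * b] ∈ tetrablock := by
  refine ⟨Matrix.diagonal ![a, b], ⟨Matrix.diagonal_transpose _, ?_⟩, by simp [tetrablockMap]⟩
  refine (Matrix.l2_opNorm_diagonal (𝕜 := ℂ) ![a, b]).trans_lt ?_
  rw [pi_norm_lt_iff one_pos, Fin.forall_fin_two]
  exact ⟨ha, hb⟩

theorem differentiable_tetrablockMap_smul (Z : Matrix (Fin 2) (Fin 2) ℂ) :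
    Differentiable ℂ fun c : ℂ => tetrablockMap (c • Z) := by
  rw [differentiable_euclidean]
  intro i
  fin_cases i
  · exact differentiable_id.mul_const (Z 0 0)
  · exact differentiable_id.mul_const (Z 1 1)
  · exact ((differentiable_id.mul_const (Z 0 0)).mul (differentiable_id.mul_const (Z 1 1))).sub
      ((differentiable_id.mul_const (Z 0 1)).pow 2)

theorem kobayashiDist_tetrablock_ne_top (z w : tetrablock) : kobayashiDist tetrablock z w ≠ ⊤ := by
  have hp := (isGreatest_kobayashiDist tetrablock).1.1
  have h00 : tetrablockMap 0 ∈ tetrablock := ⟨0, ⟨by simp, by simp⟩, rfl⟩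
  -- The radial disc `c ↦ (c / s) • Z`, with `‖Z‖ < s < 1`, joins the origin to `Z` at `c = s`.
  have key : ∀ z : tetrablock, kobayashiDist tetrablock ⟨_, h00⟩ z ≠ ⊤ := by
    rintro ⟨_, Z, ⟨hT, hZ⟩, rfl⟩
    obtain ⟨s, hs, hs1⟩ := exists_between hZ
    have hs0 : 0 < s := (norm_nonneg _).trans_lt hs
    refine ne_top_of_le_ne_top ENNReal.ofReal_ne_top (kobayashiDist_le_of_disc (α := s)
      (f := fun c => tetrablockMap (c • ((s : ℂ)⁻¹ • Z))) (by simpa [abs_of_pos hs0] using hs1)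
      (differentiable_tetrablockMap_smul _).differentiableOn (fun c hc => ?_) (by simp) ?_)
    · refine ⟨_, ⟨by simp [hT], ?_⟩, rfl⟩
      have hc' : ‖c‖ < 1 := by simpa using hc
      rw [map_smul, map_smul, norm_smul, norm_smul, norm_inv, Complex.norm_of_nonneg hs0.le,
        inv_mul_eq_div]
      exact mul_lt_one_of_nonneg_of_lt_one_left (norm_nonneg _) hc' ((div_le_one hs0).2 hs.le)
    · simp [smul_smul, hs0.ne']
  refine ne_top_of_le_ne_top (ENNReal.add_ne_top.2 ⟨?_, key w⟩) (hp.triangle z ⟨_, h00⟩ w)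
  rw [hp.symm]
  exact key z

/-! ### Failure of hyperbolicity. -/

/-- The point of the tetrablock given by the diagonal matrix with real entries `a` and `b`. -/
def realBidiscPoint (a b : ℝ) (ha : |a| < 1) (hb : |b| < 1) : tetrablock :=
  ⟨!₂[(a : ℂ), (b : ℂ), a * b], bidisc_subset_tetrablock (by simpa using ha) (by simpa using hb)⟩

theorem artanh_sub_artanh_le_kobayashiDist {z w : tetrablock} {i : Fin 3} (hi : i = 0 ∨ i = 1)
    {a b : ℝ} (ha : |a| ≤ 1) (hb : |b| ≤ 1) (hz : z.1 i = a) (hw : w.1 i = b) :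
    |Real.artanh a - Real.artanh b| ≤ (kobayashiDist tetrablock z w).toReal := by
  have h := edist_le_kobayashiDist (D := tetrablock)
    (fun v : EuclideanSpace ℂ (Fin 3) => busemann (v i)) (fun f hf hD α hα =>
      dist_busemann_le_artanh (f := fun c => f c i) (differentiableOn_euclidean.1 hf i)
        (fun c hc => by
          rcases hi with rfl | rfl
          · exact norm_apply_zero_lt_one_of_mem_tetrablock (hD hc)
          · exact norm_apply_one_lt_one_of_mem_tetrablock (hD hc)) hα) z w
  rw [hz, hw, busemann_ofReal ha, busemann_ofReal hb, edist_dist, Real.dist_eq] at h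
  exact (ENNReal.ofReal_le_iff_le_toReal (kobayashiDist_tetrablock_ne_top z w)).1 h

theorem kobayashiDist_le_artanh_of_bidisc {z w : tetrablock} {r : ℝ} (h0 : 0 ≤ r) (h1 : r < 1)
    {f g : ℂ → ℂ} (hf : Differentiable ℂ f) (hg : Differentiable ℂ g)
    (hfD : ∀ c, ‖c‖ < 1 → ‖f c‖ < 1) (hgD : ∀ c, ‖c‖ < 1 → ‖g c‖ < 1)
    (hz : !₂[f 0, g 0, f 0 * g 0] = z.1) (hw : !₂[f r, g r, f r * g r] = w.1) :
    (kobayashiDist tetrablock z w).toReal ≤ Real.artanh r := by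
  have hd : Differentiable ℂ fun c => (!₂[f c, g c, f c * g c] : EuclideanSpace ℂ (Fin 3)) := by
    rw [differentiable_euclidean]
    intro i
    fin_cases i <;> simp <;> fun_prop
  have h := kobayashiDist_le_of_disc (α := r) (by simpa [abs_of_nonneg h0] using h1)
    hd.differentiableOn (fun c hc => bidisc_subset_tetrablock (hfD c (by simpa using hc))
      (hgD c (by simpa using hc))) hz hw
  rw [Complex.norm_of_nonneg h0] at h
  exact ENNReal.toReal_le_of_le_ofReal (Real.artanh_nonneg h0) h

theorem not_isGromovHyperbolic_tetrablock :
    ¬ IsGromovHyperbolic (fun z w : tetrablock => (kobayashiDist tetrablock z w).toReal) := by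
  rintro ⟨C, hC⟩
  set t : ℝ := |C| + 1 with ht
  have ht0 : 0 < t := by positivity
  set r : ℝ := Real.tanh t
  have hr1 : r < 1 := Real.tanh_lt_one t
  have hart : Real.artanh r = t := Real.artanh_tanh t
  have hr0 : 0 ≤ r :=
    not_lt.1 fun hn => (Real.artanh_nonpos hn.le).not_gt (by rwa [hart])
  have hr : |r| < 1 := by rwa [abs_of_nonneg hr0]
  have hr' : |-r| < 1 := by rwa [abs_neg]
  have h00 : |(0 : ℝ)| < 1 := by simp
  have hartn : Real.artanh (-r) = -t := by
    rw [← Real.tanh_neg, Real.artanh_tanh]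
  have hsymm := (isGreatest_kobayashiDist tetrablock).1.1.symm
  -- In `artanh` coordinates: `p = (t, t)`, `q = (t, -t)`, their midpoint `x = (t, 0)`, and `w = (0,
  -- 0)`.
  let p := realBidiscPoint r r hr hr
  let q := realBidiscPoint r (-r) hr hr'
  let x := realBidiscPoint r 0 hr h00
  let w := realBidiscPoint 0 0 h00 h00
  have lower : ∀ v : tetrablock, v.1 0 = r → t ≤ (kobayashiDist tetrablock w v).toReal := by
    intro v hv
    have := artanh_sub_artanh_le_kobayashiDist (z := w) (.inl rfl) h00.le hr.le rfl hv
    rwa [hart, Real.artanh_zero, zero_sub, abs_neg, abs_of_pos ht0] at this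
  have hpq : 2 * t ≤ (kobayashiDist tetrablock p q).toReal := by
    have := artanh_sub_artanh_le_kobayashiDist (z := p) (w := q) (.inr rfl) hr.le hr'.le rfl rfl
    rw [hart, hartn, sub_neg_eq_add, abs_of_pos (by linarith)] at this
    linarith
  have hrc : ‖(r : ℂ)‖ < 1 := by simpa using hr
  have hwp : (kobayashiDist tetrablock w p).toReal ≤ t :=
    hart ▸ kobayashiDist_le_artanh_of_bidisc (f := id) (g := id) hr0 hr1 differentiable_id
      differentiable_id (fun _ => id) (fun _ => id) (by simp [w, realBidiscPoint])
      (by simp [p, realBidiscPoint])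
  have hwq : (kobayashiDist tetrablock w q).toReal ≤ t :=
    hart ▸ kobayashiDist_le_artanh_of_bidisc (f := id) (g := Neg.neg) hr0 hr1 differentiable_id
      differentiable_neg (fun _ => id) (fun c hc => by rwa [norm_neg])
      (by simp [w, realBidiscPoint]) (by simp [q, realBidiscPoint])
  have hxp : (kobayashiDist tetrablock x p).toReal ≤ t :=
    hart ▸ kobayashiDist_le_artanh_of_bidisc (f := fun _ => r) (g := id) hr0 hr1
      (differentiable_const _) differentiable_id (fun _ _ => hrc) (fun _ => id)
      (by simp [x, realBidiscPoint]) (by simp [p, realBidiscPoint])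
  have hxq : (kobayashiDist tetrablock x q).toReal ≤ t :=
    hart ▸ kobayashiDist_le_artanh_of_bidisc (f := fun _ => r) (g := Neg.neg) hr0 hr1
      (differentiable_const _) differentiable_neg (fun _ _ => hrc) (fun c hc => by rwa [norm_neg])
      (by simp [x, realBidiscPoint]) (by simp [q, realBidiscPoint])
  have hwp' := lower p rfl
  have hwq' := lower q rfl
  have hwx := lower x rfl
  have h := hC p q x w
  simp only [gromovProduct, hsymm p w, hsymm x w, hsymm p x] at h
  -- Both products with `x` are at least `t`, while `(p, q)_w ≤ t + t - 2 * t = 0`; this contradicts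
  -- `t > C`.
  have hmin : t ≤ min
      ((kobayashiDist tetrablock w p).toReal + (kobayashiDist tetrablock w x).toReal -
        (kobayashiDist tetrablock x p).toReal)
      ((kobayashiDist tetrablock w x).toReal + (kobayashiDist tetrablock w q).toReal -
        (kobayashiDist tetrablock x q).toReal) := le_min (by linarith) (by linarith)
  linarith [le_abs_self C]

/-- The Kobayashi distance of the tetrablock is a (finite) distance, and the tetrablock with this
distance is not Gromov hyperbolic. -/
theorem proposition4 :
    (∀ z w : tetrablock, kobayashiDist tetrablock z w ≠ ⊤) ∧
    (∀ z w : tetrablock, kobayashiDist tetrablock z w = 0 → z = w) ∧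
    ¬ IsGromovHyperbolic (fun z w : tetrablock => (kobayashiDist tetrablock z w).toReal) :=
  ⟨kobayashiDist_tetrablock_ne_top,
    fun _ _ => eq_of_kobayashiDist_eq_zero three_pos fun _ => norm_le_of_mem_tetrablock,
    not_isGromovHyperbolic_tetrablock⟩
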